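/- A permutation of order $n$ is a sequence containing each of $1,\dots,n$ exactly once; $\pi$ contains $\sigma$ if some subsequence of $\pi$ is order-isomorphic to $\sigma$, and $\mathrm{Av}(\sigma)$ is the class of all permutations that do not contain $\sigma$. Let $1\oplus\delta_n$ be the permutation $1,\,n+1,\,n,\dots,3,\,2$ of order $n+1$. A class $C$ of permutations admits the splitting into $k$ copies of a class $D$ if for every $\pi\in C$ the elements of $\pi$ can be colored by $k$ colors so that, for each color, the (possibly empty) subsequence of the elements of that color is order-isomorphic to a member of $D$ (where the empty permutation is counted as a member of $D$). A circle graph is a graph isomorphic to the intersection graph of an ordered perfect matching $M$ on a finite set of real points: its vertices are the arcs $(a,b)$, $a<b$, of $M$, and two arcs $(a,b)$, $(c,d)$ are adjacent if they cross, i.e. $a<c<b<d$ or $c<a<d<b$. Let $n\ge 1$ and $k\ge 0$ be integers with $(n,k)\ne(1,0)$. Then $\mathrm{Av}(1\oplus\delta_n)$ admits the splitting into $k$ copies of $\mathrm{Av}(132)$ if and only if every $K_n$-free circle graph can be properly colored by $k$ colors. Moreover, for every $n\ge 2$, there is a smallest integer $f(n)\ge 0$ such that $\mathrm{Av}(1\oplus\delta_n)$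 admits the splitting into $f(n)$ copies of $\mathrm{Av}(132)$, the chromatic numbers of $K_n$-free circle graphs have a largest element, and $f(n)$ is equal to it. -/

import Mathlib

namespace PermSplitting

/-- A permutation together with its order: `⟨n, π⟩` with `π` a permutation of `{0, …, n - 1}`.
The empty permutation (`n = 0`) is included, since a merge may use empty permutations. -/
abbrev FinPerm : Type := Σ n : ℕ, Equiv.Perm (Fin n)

/-- `f` is an embedding of the pattern `σ` into `π`: the subsequence of `π` at the positions
`f 0 < f 1 < …` is order-isomorphic to `σ`. -/
def IsEmbedding {m n : ℕ} (σ : Equiv.Perm (Fin m)) (π : Equiv.Perm (Fin n))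
    (f : Fin m → Fin n) : Prop :=
  StrictMono f ∧ ∀ i j : Fin m, σ i < σ j ↔ π (f i) < π (f j)

/-- `π` contains the pattern `σ`. -/
def Contains {m n : ℕ} (π : Equiv.Perm (Fin n)) (σ : Equiv.Perm (Fin m)) : Prop :=
  ∃ f : Fin m → Fin n, IsEmbedding σ π f

/-- The principal class `Av(σ)` of all `σ`-avoiding permutations. -/
def Av {m : ℕ} (σ : Equiv.Perm (Fin m)) : Set FinPerm :=
  {π | ¬ Contains π.2 σ}

/-- The direct sum `σ ⊕ π`: the sequence `σ` followed by the sequence `π` shifted up by `m`. -/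
def directSum {m n : ℕ} (σ : Equiv.Perm (Fin m)) (π : Equiv.Perm (Fin n)) :
    Equiv.Perm (Fin (m + n)) :=
  finSumFinEquiv.permCongr (Equiv.Perm.sumCongr σ π)

/-- The decreasing permutation `n (n - 1) ⋯ 2 1` of order `n`. -/
def decreasing (n : ℕ) : Equiv.Perm (Fin n) := Fin.revPerm

/-- The permutation `1 ⊕ δ_n`, where `δ_n` is the decreasing permutation of order `n`. -/
def oneSumDecreasing (n : ℕ) : Equiv.Perm (Fin (1 + n)) :=
  directSum (1 : Equiv.Perm (Fin 1)) (decreasing n)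

/-- The permutation `132`. -/
def perm132 : Equiv.Perm (Fin 3) := Equiv.swap 1 2

/-- The set of all permutations that can be merged from `k` (possibly empty) permutations, the
`i`-th one belonging to `P i`: the positions can be coloured by `k` colours so that, for each
colour `i`, the elements of colour `i` form an occurrence of a permutation from `P i`. -/
def mergeOf {k : ℕ} (P : Fin k → Set FinPerm) : Set FinPerm :=
  {π | ∃ c : Fin π.1 → Fin k, ∀ i : Fin k,
    ∃ ρ ∈ P i, ∃ f : Fin ρ.1 → Fin π.1,
      IsEmbedding ρ.2 π.2 f ∧ Set.range f = {x | c x = i}}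

/-- The multiset `{P 0, …, P (k - 1)}` forms a splitting of `C`. -/
def IsSplitting (C : Set FinPerm) {k : ℕ} (P : Fin k → Set FinPerm) : Prop :=
  C ⊆ mergeOf P

/-- `C` admits the splitting that consists of `k` copies of `D`. -/
def SplitsIntoCopies (C : Set FinPerm) (k : ℕ) (D : Set FinPerm) : Prop :=
  IsSplitting C (fun _ : Fin k => D)

/-- An ordered perfect matching on a finite set of real points. An arc is the pair of its left
and its right endpoint. -/
structure OrderedMatching where
  /-- the endpoints -/
  points : Finset ℝ
  /-- the arcs -/
  arcs : Finset (ℝ × ℝ)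
  left_lt_right : ∀ α ∈ arcs, α.1 < α.2
  endpoints_mem : ∀ α ∈ arcs, α.1 ∈ points ∧ α.2 ∈ points
  existsUnique_arc : ∀ x ∈ points, ∃! α : ℝ × ℝ, α ∈ arcs ∧ (α.1 = x ∨ α.2 = x)

/-- `α` crosses `β` from the left. -/
def CrossesFromLeft (α β : ℝ × ℝ) : Prop :=
  α.1 < β.1 ∧ β.1 < α.2 ∧ α.2 < β.2

/-- The intersection graph of a matching: the vertices are the arcs, and two arcs are adjacent
when they cross. -/
def OrderedMatching.intersectionGraph (M : OrderedMatching) : SimpleGraph M.arcs where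
  Adj α β := CrossesFromLeft α.1 β.1 ∨ CrossesFromLeft β.1 α.1
  symm := ⟨fun _ _ h => h.symm⟩
  loopless := ⟨fun _ h => h.elim (fun h => lt_irrefl _ h.1) (fun h => lt_irrefl _ h.1)⟩

/-- A circle graph is a graph isomorphic to the intersection graph of a matching. -/
def IsCircleGraph {V : Type} (G : SimpleGraph V) : Prop :=
  ∃ M : OrderedMatching, Nonempty (G ≃g M.intersectionGraph)

end PermSplitting

open PermSplitting

/-! The bridge between the two sides is the overlap graph of intervals in a linear order, which is
the same thing as a circle graph (`overlapBound_iff`). By `mem_mergeOf_av_iff`, a splitting into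
copies of `Av(132)` is a colouring of the elements without a monochromatic `132`.

If `K_n`-free circle graphs are `k`-colourable (`splits_of_overlapBound`), represent each element
of a permutation in `Av(1 ⊕ δ_n)` by the interval of left-to-right minima below and to the left of
it. Crossing pairs are exactly the pairs `32` of the occurrences of `132`, and `n`-cliques yield
occurrences of `1 ⊕ δ_n`, so a proper colouring of this graph is what is needed.

Conversely (`overlapBound_of_splits`), a `K_n`-free family of intervals is drawn as the
non-minima of such a permutation, with a left-to-right minimum for every left endpoint. The colours
of the minima have to be controlled: for the least `k`, some `τ` in `Av(1 ⊕ δ_n)` has all `k`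
colours in each of its colourings. Inflating the minima by `τ` creates no `1 ⊕ δ_n`
(`not_isOccurrence_inflated`), and now a crossing pair of equal colour always completes to a
monochromatic `132`.

The second part also needs that `K_n`-free circle graphs have bounded chromatic number
(`exists_overlapBound`), by induction on `n`. In each component take distances from the leftmost
interval. In a layer, every interval is crossed from the left, say, by one of the previous layer,
hence contains a point of the set `T` of right endpoints of the previous layer; and all intervals
of the layer over one point of `T` are crossed by the same interval. So the crossings over points
of `T` form a `K_{n-1}`-free overlap graph. In a colour class of that graph, the intervals are
pairwise non-crossing arcs on the gaps of `T`, and crossing intervals are consecutive arcs, so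
that a 3-colouring of an outerplanar graph finishes the proof (`colorable_three_of_stabbed`). -/

namespace PermSplitting

/-! ### Overlap graphs of intervals in a linear order -/

/-- The interval with endpoints `l x`, `r x` crosses the one with endpoints `l y`, `r y` from the
left. -/
def CrossesLeft {V α : Type} [LinearOrder α] (l r : V → α) (x y : V) : Prop :=
  l x < l y ∧ l y < r x ∧ r x < r y

/-- The overlap graph of the intervals `(l x, r x)`: two of them are adjacent when they cross. -/
def overlapGraph {V α : Type} [LinearOrder α] (l r : V → α) : SimpleGraph V where
  Adj x y := CrossesLeft l r x y ∨ CrossesLeft l r y x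
  symm := ⟨fun _ _ h => h.symm⟩
  loopless := ⟨fun _ h => h.elim (fun h => lt_irrefl _ h.1) (fun h => lt_irrefl _ h.1)⟩

/-- All `l x` and `r x` are pairwise distinct, and `l x < r x`. -/
structure IsIntervalFamily {V α : Type} [LinearOrder α] (l r : V → α) : Prop where
  lt : ∀ x, l x < r x
  left_inj : Function.Injective l
  right_inj : Function.Injective r
  left_ne_right : ∀ x y, l x ≠ r y

section

variable {V W α : Type} [LinearOrder α] {l r : V → α}

theorem IsIntervalFamily.comp (h : IsIntervalFamily l r) {f : W → V}
    (hf : Function.Injective f) : IsIntervalFamily (l ∘ f) (r ∘ f) :=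
  ⟨fun _ => h.lt _, h.left_inj.comp hf, h.right_inj.comp hf, fun _ _ => h.left_ne_right _ _⟩

theorem IsIntervalFamily.dual (h : IsIntervalFamily l r) :
    IsIntervalFamily (OrderDual.toDual ∘ r) (OrderDual.toDual ∘ l) :=
  ⟨fun x => OrderDual.toDual_lt_toDual.2 (h.lt x), OrderDual.toDual.injective.comp h.right_inj,
    OrderDual.toDual.injective.comp h.left_inj, fun x y e => h.left_ne_right y x
      (OrderDual.toDual.injective e).symm⟩

theorem crossesLeft_dual {x y : V} :
    CrossesLeft (OrderDual.toDual ∘ r) (OrderDual.toDual ∘ l) x y ↔ CrossesLeft l r y x :=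
  ⟨fun h => ⟨h.2.2, h.2.1, h.1⟩, fun h => ⟨h.2.2, h.2.1, h.1⟩⟩

theorem overlapGraph_dual :
    overlapGraph (OrderDual.toDual ∘ r) (OrderDual.toDual ∘ l) = overlapGraph l r := by
  ext x y
  exact (or_congr crossesLeft_dual crossesLeft_dual).trans or_comm

end

/-! ### Combining colourings -/

/-- If adjacent vertices with equal labels `p` lie in one fibre of `c`, and the fibres of `c` are
`K`-colourable, then the labels and the colourings of the fibres combine to a colouring. -/
theorem colorable_of_fibers {V ι κ : Type} [Fintype κ] (G : SimpleGraph V) (c : V → ι) (p : V → κ)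
    (K : ℕ) (hcp : ∀ x y, G.Adj x y → p x = p y → c x = c y)
    (hK : ∀ i, (G.induce {x | c x = i}).Colorable K) :
    G.Colorable (Fintype.card κ * K) := by
  have d := fun i => (hK i).some
  have C : G.Coloring (κ × Fin K) := SimpleGraph.Coloring.mk
    (fun x => (p x, d (c x) ⟨x, rfl⟩)) (by
      intro x y hxy he
      obtain ⟨h1, h2⟩ := Prod.mk.inj he
      have hc := hcp x y hxy h1
      have key : ∀ (i : ι) (hi : c y = i), d i ⟨y, hi⟩ = d (c y) ⟨y, rfl⟩ := by
        rintro _ rfl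
        rfl
      rw [← key (c x) hc.symm] at h2
      refine (d (c x)).valid (v := ⟨x, rfl⟩) (w := ⟨y, hc.symm⟩) ?_ h2
      exact hxy)
  simpa using C.colorable

/-! ### Intervals stabbed by a set of points -/

/-- A set of pairwise non-crossing arcs on the points of `[a, b]` forms an outerplanar graph, and
distinct colours of the two extreme points extend to a proper colouring of it by three colours. -/
theorem exists_three_coloring_of_noncrossing (H : ℕ → ℕ → Prop)
    (hH : ∀ a b c d, H a b → H c d → a < c → c < b → b < d → False) (m : ℕ) :
    ∀ a b, b - a = m → a < b → ∀ p q : Fin 3, p ≠ q → ∃ φ : ℕ → Fin 3, φ a = p ∧ φ b = q ∧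
      ∀ u v, a ≤ u → u < v → v ≤ b → H u v → φ u ≠ φ v := by
  induction m using Nat.strong_induction_on with
  | _ m ih =>
  intro a b hm hab p q hpq
  rcases Nat.eq_or_lt_of_le (Nat.succ_le_of_lt hab) with hb | hb
  · refine ⟨fun z => if z = a then p else q, by simp, by simp [hab.ne'], ?_⟩
    intro u v hu huv hv _
    have : u = a := by omega
    have : v ≠ a := by omega
    simp [*]
  · obtain ⟨s, hsp, hsq⟩ : ∃ s : Fin 3, s ≠ p ∧ s ≠ q := by
      revert p q; decide
    -- `c` is the last neighbour of `a` before `b`; if there is none, the successor of `a`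
    obtain ⟨c, hac, hcb, hc, hmax⟩ : ∃ c, a < c ∧ c < b ∧ (H a c ∨ c = a + 1) ∧
        ∀ c', c < c' → c' < b → ¬ H a c' := by
      classical
      have hne : ((Finset.Ioo a b).filter fun c => H a c ∨ c = a + 1).Nonempty :=
        ⟨a + 1, by simp; omega⟩
      have hmem := Finset.max'_mem _ hne
      simp only [Finset.mem_filter, Finset.mem_Ioo] at hmem
      refine ⟨_, hmem.1.1, hmem.1.2, hmem.2, fun c' h1 h2 h3 => ?_⟩
      have := Finset.le_max' ((Finset.Ioo a b).filter fun c => H a c ∨ c = a + 1) c' (by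
        simp only [Finset.mem_filter, Finset.mem_Ioo]
        exact ⟨⟨hmem.1.1.trans h1, h2⟩, Or.inl h3⟩)
      omega
    obtain ⟨φ, hφa, hφc, hφ⟩ := ih (c - a) (by omega) a c rfl hac p s hsp.symm
    obtain ⟨ψ, hψc, hψb, hψ⟩ := ih (b - c) (by omega) c b rfl hcb s q hsq
    refine ⟨fun z => if z ≤ c then φ z else ψ z, by simp [hac.le, hφa],
      by simp [not_le.2 hcb, hψb], ?_⟩
    intro u v hu huv hv huvH
    by_cases hvc : v ≤ c
    · simpa [hvc, huv.le.trans hvc] using hφ u v hu huv hvc huvH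
    by_cases huc : u < c
    · rcases Nat.eq_or_lt_of_le hu with rfl | hau
      · have : v = b := by
          by_contra hne
          exact hmax v (not_le.1 hvc) (by omega) huvH
        subst this
        simpa [hvc, hac.le, hφa, hψb] using hpq
      · rcases hc with hc | hc
        · exact (hH a c u v hc huvH hau huc (not_le.1 hvc)).elim
        · omega
    · have h := hψ u v (not_lt.1 huc) huv hv huvH
      rcases Nat.eq_or_lt_of_le (not_lt.1 huc) with rfl | hcu
      · simpa [hvc, hφc, hψc] using hψc ▸ h
      · simpa [hvc, not_le.2 hcu] using h

section

variable {V α : Type} [LinearOrder α] {l r : V → α}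

/-- The number of points of `T` below `z`, that is, the index of the gap of `T` containing `z`. -/
def gapIndex (T : Finset α) (z : α) : ℕ := (T.filter (· < z)).card

theorem gapIndex_mono (T : Finset α) : Monotone (gapIndex T) := fun _ _ h =>
  Finset.card_le_card (Finset.monotone_filter_right _ fun _ _ ht => lt_of_lt_of_le ht h)

theorem lt_of_gapIndex_lt {T : Finset α} {y z : α} (h : gapIndex T y < gapIndex T z) : y < z :=
  not_le.1 fun h' => (gapIndex_mono T h').not_gt h

theorem gapIndex_lt_iff {T : Finset α} {y z : α} (hy : y ∉ T) :
    gapIndex T y < gapIndex T z ↔ ∃ t ∈ T, y < t ∧ t < z := by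
  constructor
  · intro h
    by_contra! hn
    refine h.not_ge (Finset.card_le_card fun t ht => ?_)
    simp only [Finset.mem_filter] at ht ⊢
    refine ⟨ht.1, lt_of_le_of_ne (not_lt.1 fun h' => ?_) fun e => hy (e ▸ ht.1)⟩
    exact (hn t ht.1 h').not_gt ht.2
  · rintro ⟨t, ht, hyt, htz⟩
    refine Finset.card_lt_card ⟨?_, fun hs => ?_⟩
    · exact Finset.monotone_filter_right _ fun _ _ hs => hs.trans (hyt.trans htz)
    · have := hs (Finset.mem_filter.2 ⟨ht, htz⟩)
      exact (Finset.mem_filter.1 this).2.not_gt hyt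

/-- If every interval contains a point of `T` but no intersection of two crossing intervals does,
then crossing intervals are consecutive arcs of an outerplanar graph on the gaps of `T`, so a
proper colouring of the gaps, read off at left endpoints, is a proper colouring. -/
theorem colorable_three_of_stabbed (T : Finset α) (hT : ∀ x, l x ∉ T)
    (hstab : ∀ x, ∃ t ∈ T, l x < t ∧ t < r x)
    (hno : ∀ x y, CrossesLeft l r x y → ∀ t ∈ T, ¬ (l y < t ∧ t < r x)) :
    (overlapGraph l r).Colorable 3 := by
  have hlt : ∀ x, gapIndex T (l x) < gapIndex T (r x) := fun x =>
    (gapIndex_lt_iff (hT x)).2 (hstab x)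
  obtain ⟨φ, -, -, hφ⟩ := exists_three_coloring_of_noncrossing
    (fun a b => ∃ x, gapIndex T (l x) = a ∧ gapIndex T (r x) = b) (by
      rintro _ _ _ _ ⟨x, rfl, rfl⟩ ⟨y, rfl, rfl⟩ h1 h2 h3
      obtain ⟨t, ht, h4⟩ := (gapIndex_lt_iff (hT y)).1 h2
      exact hno x y ⟨lt_of_gapIndex_lt h1, lt_of_gapIndex_lt h2, lt_of_gapIndex_lt h3⟩ t ht h4)
    (T.card + 1) 0 (T.card + 1) rfl (Nat.succ_pos _) 0 1 (by decide)
  have key : ∀ x y, CrossesLeft l r x y → φ (gapIndex T (l x)) ≠ φ (gapIndex T (l y)) := by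
    intro x y hxy
    have he : gapIndex T (l y) = gapIndex T (r x) := by
      refine le_antisymm (gapIndex_mono T hxy.2.1.le) (not_lt.1 fun h => ?_)
      obtain ⟨t, ht, h4⟩ := (gapIndex_lt_iff (hT y)).1 h
      exact hno x y hxy t ht h4
    rw [he]
    exact hφ _ _ (Nat.zero_le _) (hlt x)
      ((Finset.card_filter_le _ _).trans (Nat.le_succ _)) ⟨x, rfl, rfl⟩
  exact ⟨SimpleGraph.Coloring.mk (fun x => φ (gapIndex T (l x))) fun {x y} h =>
    h.elim (key x y) fun h => (key y x h).symm⟩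

/-- The number `K` of colours suffices for every overlap graph without a clique of order `n`. -/
def OverlapBound (n K : ℕ) : Prop :=
  ∀ (V α : Type) [Finite V] [LinearOrder α] (l r : V → α), IsIntervalFamily l r →
    (overlapGraph l r).CliqueFree n → (overlapGraph l r).Colorable K

/-- The left endpoint `z`, tagged so that, in each gap of `T`, all right endpoints precede all left
endpoints while the order among endpoints of the same kind is kept. -/
def tagLeft (T : Finset α) (z : α) : ℕ ×ₗ (Bool ×ₗ α) :=
  toLex (gapIndex T z, toLex (true, z))

/-- The right endpoint `z`, tagged as in `tagLeft`. -/
def tagRight (T : Finset α) (z : α) : ℕ ×ₗ (Bool ×ₗ α) :=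
  toLex (gapIndex T z, toLex (false, z))

theorem tagLeft_lt_tagLeft {T : Finset α} {y z : α} : tagLeft T y < tagLeft T z ↔ y < z := by
  rw [tagLeft, tagLeft, Prod.Lex.toLex_lt_toLex]
  simp only [Prod.Lex.toLex_lt_toLex]
  constructor
  · rintro (h | ⟨-, h⟩)
    · exact lt_of_gapIndex_lt h
    · simpa using h
  · intro h
    rcases (gapIndex_mono T h.le).lt_or_eq with h' | h'
    · exact Or.inl h'
    · exact Or.inr ⟨h', Or.inr ⟨trivial, h⟩⟩

theorem tagRight_lt_tagRight {T : Finset α} {y z : α} : tagRight T y < tagRight T z ↔ y < z := by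
  rw [tagRight, tagRight, Prod.Lex.toLex_lt_toLex]
  simp only [Prod.Lex.toLex_lt_toLex]
  constructor
  · rintro (h | ⟨-, h⟩)
    · exact lt_of_gapIndex_lt h
    · simpa using h
  · intro h
    rcases (gapIndex_mono T h.le).lt_or_eq with h' | h'
    · exact Or.inl h'
    · exact Or.inr ⟨h', Or.inr ⟨trivial, h⟩⟩

theorem tagLeft_lt_tagRight {T : Finset α} {y z : α} :
    tagLeft T y < tagRight T z ↔ gapIndex T y < gapIndex T z := by
  rw [tagLeft, tagRight, Prod.Lex.toLex_lt_toLex]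
  simp [Prod.Lex.toLex_lt_toLex]

theorem IsIntervalFamily.tag (h : IsIntervalFamily l r) (T : Finset α) (hT : ∀ x, l x ∉ T)
    (hstab : ∀ x, ∃ t ∈ T, l x < t ∧ t < r x) :
    IsIntervalFamily (tagLeft T ∘ l) (tagRight T ∘ r) where
  lt x := tagLeft_lt_tagRight.2 ((gapIndex_lt_iff (hT x)).2 (hstab x))
  left_inj _ _ e := h.left_inj (congrArg (fun z => (ofLex (ofLex z).2).2) e)
  right_inj _ _ e := h.right_inj (congrArg (fun z => (ofLex (ofLex z).2).2) e)
  left_ne_right _ _ e :=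
    Bool.noConfusion (show true = false from congrArg (fun z => (ofLex (ofLex z).2).1) e)

theorem crossesLeft_tag {T : Finset α} (hT : ∀ x, l x ∉ T) {x y : V} :
    CrossesLeft (tagLeft T ∘ l) (tagRight T ∘ r) x y ↔
      CrossesLeft l r x y ∧ ∃ t ∈ T, l y < t ∧ t < r x := by
  simp only [CrossesLeft, Function.comp, tagLeft_lt_tagLeft, tagRight_lt_tagRight,
    tagLeft_lt_tagRight, gapIndex_lt_iff (hT y)]
  constructor
  · rintro ⟨h1, ⟨t, h2, h3, h4⟩, h5⟩
    exact ⟨⟨h1, h3.trans h4, h5⟩, t, h2, h3, h4⟩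
  · rintro ⟨⟨h1, h2, h3⟩, h4⟩
    exact ⟨h1, h4, h3⟩

/-- Suppose that every interval contains a point of `T`. The crossings whose intersection contains
a point of `T` form an overlap graph, and by the Helly property each of its cliques lies over one
point of `T`. Colour this graph, and then each of its colour classes. -/
theorem colorable_of_stabbed [Finite V] (h : IsIntervalFamily l r) (T : Finset α)
    (hT : ∀ x, l x ∉ T) (hstab : ∀ x, ∃ t ∈ T, l x < t ∧ t < r x) {n K : ℕ} (hn : n ≠ 0)
    (hK : OverlapBound n K)
    (hclique : ∀ t ∈ T, ∀ s : Finset V, (∀ x ∈ s, l x < t ∧ t < r x) →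
      ¬ (overlapGraph l r).IsNClique n s) :
    (overlapGraph l r).Colorable (K * 3) := by
  obtain ⟨c⟩ := hK V _ (tagLeft T ∘ l) (tagRight T ∘ r) (h.tag T hT hstab) (by
    intro s hs
    have hne : s.Nonempty := Finset.card_pos.1 (hs.card_eq ▸ Nat.pos_of_ne_zero hn)
    obtain ⟨x, hx, hxmax⟩ := s.exists_max_image l hne
    obtain ⟨y, hy, hymin⟩ := s.exists_min_image r hne
    obtain ⟨t, ht, hxt, hty⟩ : ∃ t ∈ T, l x < t ∧ t < r y := by
      by_cases hxy : x = y
      · exact hxy ▸ hstab x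
      · rcases hs.isClique hx hy hxy with h1 | h1
        · exact ((hxmax y hy).not_gt ((crossesLeft_tag hT).1 h1).1.1).elim
        · exact ((crossesLeft_tag hT).1 h1).2
    refine hclique t ht s
      (fun z hz => ⟨(hxmax z hz).trans_lt hxt, hty.trans_le (hymin z hz)⟩) ⟨?_, hs.card_eq⟩
    intro u hu v hv huv
    exact (hs.isClique hu hv huv).imp (fun h => ((crossesLeft_tag hT).1 h).1)
      fun h => ((crossesLeft_tag hT).1 h).1)
  have := colorable_of_fibers (overlapGraph l r) c c 3 (fun _ _ _ h => h) (fun i =>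
    colorable_three_of_stabbed (l := fun x : {x | c x = i} => l x) (r := fun x => r x) T
      (fun x => hT x) (fun x => hstab x) (fun x y hxy t ht htt =>
        c.valid (Or.inl ((crossesLeft_tag hT).2 ⟨hxy, t, ht, htt⟩)) (x.2.trans y.2.symm)))
  simpa using this

/-- The intervals of `S` are each crossed from the left by an interval of `Y` and contain no
interval of `Y`, so an interval of `Y` crosses every member of `S` over its right endpoint. -/
theorem colorable_induce_of_crossed [Finite V] (h : IsIntervalFamily l r) (S Y : Set V)
    (hcross : ∀ x ∈ S, ∃ y ∈ Y, CrossesLeft l r y x)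
    (hsub : ∀ x ∈ S, ∀ y ∈ Y, ¬ (l x < l y ∧ r y < r x)) {n K : ℕ} (hn : n ≠ 0)
    (hK : OverlapBound n K) (hfree : (overlapGraph l r).CliqueFree (n + 1)) :
    ((overlapGraph l r).induce S).Colorable (K * 3) := by
  classical
  have hmem : ∀ t, t ∈ (Set.toFinite (r '' Y)).toFinset ↔ ∃ y ∈ Y, r y = t := by simp
  refine colorable_of_stabbed (l := fun x : S => l x) (r := fun x => r x)
    (h.comp Subtype.val_injective) (Set.toFinite (r '' Y)).toFinset ?_ ?_ hn hK ?_
  · intro x hx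
    obtain ⟨y, -, hy⟩ := (hmem _).1 hx
    exact h.left_ne_right _ _ hy.symm
  · rintro ⟨x, hx⟩
    obtain ⟨y, hy, hyx⟩ := hcross x hx
    exact ⟨r y, (hmem _).2 ⟨y, hy, rfl⟩, hyx.2⟩
  · intro t ht s hs hcl
    obtain ⟨y, hy, rfl⟩ := (hmem t).1 ht
    have hyx : ∀ x ∈ s, CrossesLeft l r y x := by
      intro x hx
      refine ⟨lt_of_le_of_ne (not_lt.1 fun hl => ?_) fun e => ?_, hs x hx⟩
      · exact hsub x x.2 y hy ⟨hl, (hs x hx).2⟩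
      · exact (hs x hx).2.ne (congrArg r (h.left_inj e))
    refine hfree _
      (((hcl.map (f := Function.Embedding.subtype (· ∈ S))).mono ?_).insert (a := y) ?_)
    · rintro _ _ ⟨-, a, b, hab, rfl, rfl⟩
      exact hab
    · intro b hb
      obtain ⟨x, hx, rfl⟩ := Finset.mem_map.1 hb
      exact Or.inl (hyx x hx)

/-! ### Distance layers and the bound on the chromatic number -/

/-- A walk that starts at an interval contained in `x` and ends at one that is not contained in
`x` passes through an interval crossing `x`. -/
theorem exists_mem_support_adj (h : IsIntervalFamily l r) (x : V) {u w : V}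
    (p : (overlapGraph l r).Walk u w) (hu : l x < l u ∧ r u < r x)
    (hw : ¬ (l x < l w ∧ r w < r x)) : ∃ z ∈ p.support, (overlapGraph l r).Adj z x := by
  induction p with
  | nil => exact (hw hu).elim
  | @cons u v w huv p ih =>
    by_cases hv : l x < l v ∧ r v < r x
    · obtain ⟨z, hz, hzx⟩ := ih hv hw
      exact ⟨z, by simp [hz], hzx⟩
    · refine ⟨v, by simp, ?_⟩
      rcases huv with ⟨h1, h2, -⟩ | ⟨-, h2, h3⟩
      · have hl : l x < l v := hu.1.trans h1
        refine Or.inr ⟨hl, h2.trans hu.2,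
          lt_of_le_of_ne (not_lt.1 fun hr => hv ⟨hl, hr⟩) fun e => ?_⟩
        exact hl.ne (congrArg l (h.right_inj e))
      · have hr : r v < r x := h3.trans hu.2
        refine Or.inl ⟨lt_of_le_of_ne (not_lt.1 fun hl => hv ⟨hl, hr⟩) fun e => ?_,
          hu.1.trans h2, hr⟩
        exact hr.ne (congrArg r (h.left_inj e))

/-- Distances are taken from an interval `v` whose left endpoint is not to the right of that of
`x`. A shortest walk from a contained interval `y` to `v` would leave `x`, and so cross `x`, at an
interval closer to `v` than `y`. -/
theorem not_contains_of_dist_eq_succ (h : IsIntervalFamily l r) {v x y : V} (hv : l v ≤ l x)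
    (hd : (overlapGraph l r).dist v x = (overlapGraph l r).dist v y + 1)
    (hvy : (overlapGraph l r).Reachable v y) : ¬ (l x < l y ∧ r y < r x) := by
  classical
  intro hc
  obtain ⟨p, hp⟩ := hvy.symm.exists_walk_length_eq_dist
  obtain ⟨z, hz, hzx⟩ := exists_mem_support_adj h x p hc fun hw => hv.not_gt hw.1
  have hzy : z ≠ y := by
    rintro rfl
    rcases hzx with hzx | hzx
    · exact hzx.1.not_gt hc.1
    · exact hzx.2.2.not_gt hc.2
  have h1 : (p.dropUntil z hz).length < p.length := by
    have h2 : (p.takeUntil z hz).length ≠ 0 := fun e =>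
      hzy (SimpleGraph.Walk.eq_of_length_eq_zero e).symm
    have h3 := congrArg SimpleGraph.Walk.length (p.take_spec hz)
    rw [SimpleGraph.Walk.length_append] at h3
    omega
  have h4 := SimpleGraph.dist_le ((p.dropUntil z hz).reverse.concat hzx)
  rw [SimpleGraph.Walk.length_concat, SimpleGraph.Walk.length_reverse] at h4
  rw [SimpleGraph.dist_comm (u := y)] at hp
  omega

theorem dist_le_succ_of_adj {V : Type} {G : SimpleGraph V} {v x y : V} (hx : G.Reachable v x)
    (hxy : G.Adj x y) : G.dist v y ≤ G.dist v x + 1 := by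
  obtain ⟨p, hp⟩ := hx.exists_walk_length_eq_dist
  rw [← hp, ← SimpleGraph.Walk.length_concat p hxy]
  exact SimpleGraph.dist_le _

theorem exists_adj_dist_eq {V : Type} {G : SimpleGraph V} {v x : V} {d : ℕ} (hx : G.Reachable v x)
    (hd : G.dist v x = d + 1) : ∃ y, G.Adj y x ∧ G.Reachable v y ∧ G.dist v y = d := by
  obtain ⟨p, hp⟩ := hx.symm.exists_walk_length_eq_dist
  rw [SimpleGraph.dist_comm, hd] at hp
  cases p with
  | nil => simp at hp
  | @cons _ y _ hxy q =>
    rw [SimpleGraph.Walk.length_cons] at hp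
    refine ⟨y, hxy.symm, q.reachable.symm, ?_⟩
    have h1 := SimpleGraph.dist_le q.reverse
    have h2 := dist_le_succ_of_adj q.reachable.symm hxy.symm
    rw [SimpleGraph.Walk.length_reverse] at h1
    omega

/-- In each component take the distances from the interval with the leftmost left endpoint.
Adjacent intervals have equal or consecutive distances, so parities separate the layers, and
within a layer each interval is crossed, from the left or from the right, by one of the previous
layer. -/
theorem OverlapBound.succ {n K : ℕ} (hn : n ≠ 0) (hK : OverlapBound n K) :
    OverlapBound (n + 1) (4 * ((K + 1) * 3)) := by
  classical
  intro V α _ _ l r h hfree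
  replace hK : OverlapBound n (K + 1) := fun V α _ _ l r h hf => (hK V α l r h hf).mono K.le_succ
  set G := overlapGraph l r with hG
  have hroot : ∀ C : G.ConnectedComponent, ∃ v ∈ C.supp, ∀ y ∈ C.supp, l v ≤ l y := fun C =>
    C.supp.exists_min_image l (Set.toFinite _) C.nonempty_supp
  choose root hroot hmin using hroot
  have hreach : ∀ x, G.Reachable (root (G.connectedComponentMk x)) x := fun x =>
    SimpleGraph.ConnectedComponent.exact (hroot (G.connectedComponentMk x))
  let D : V → ℕ := fun x => G.dist (root (G.connectedComponentMk x)) x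
  let side : V → Bool := fun x => decide (∃ y, CrossesLeft l r y x ∧ D x = D y + 1)
  have hadj : ∀ x y, G.Adj x y → G.connectedComponentMk x = G.connectedComponentMk y :=
    fun x y hxy => SimpleGraph.ConnectedComponent.sound hxy.reachable
  have := colorable_of_fibers G
    (fun x => (G.connectedComponentMk x, D x, side x))
    (fun x => (decide (D x % 2 = 0), side x)) ((K + 1) * 3) ?_ ?_
  · simpa using this
  · intro x y hxy hp
    simp only [Prod.mk.injEq, decide_eq_decide] at hp ⊢
    refine ⟨hadj x y hxy, ?_, hp.2⟩
    have h1 : D x ≤ D y + 1 ∧ D y ≤ D x + 1 := by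
      have h2 := dist_le_succ_of_adj (hreach x) hxy
      have h3 := dist_le_succ_of_adj (hreach y) hxy.symm
      rw [← hadj x y hxy] at h3
      simp only [D]
      rw [← hadj x y hxy]
      omega
    omega
  · rintro ⟨C, d, b⟩
    have hC : ∀ x, G.connectedComponentMk x = C →
        D x = G.dist (root C) x ∧ G.Reachable (root C) x ∧ l (root C) ≤ l x := by
      rintro x rfl
      exact ⟨rfl, hreach x, hmin _ x rfl⟩
    rcases d with _ | d
    · -- the layer of distance zero is a single interval
      have hss : Subsingleton {x | (G.connectedComponentMk x, D x, side x) = (C, 0, b)} := by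
        refine ⟨fun ⟨x, hx⟩ ⟨y, hy⟩ => Subtype.ext ?_⟩
        simp only [Set.mem_ofPred_eq, Prod.mk.injEq] at hx hy
        have h1 := hC x hx.1
        have h2 := hC y hy.1
        have h3 := h1.2.1.dist_eq_zero_iff.1 (h1.1 ▸ hx.2.1)
        have h4 := h2.2.1.dist_eq_zero_iff.1 (h2.1 ▸ hy.2.1)
        exact h3.symm.trans h4
      exact SimpleGraph.Colorable.mono (n := 1) (by omega)
        ⟨SimpleGraph.Coloring.mk (fun _ => 0) fun {u v} huv => (huv.ne (hss.elim u v)).elim⟩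
    · have hsub : ∀ x ∈ {x | (G.connectedComponentMk x, D x, side x) = (C, d + 1, b)},
          ∀ y ∈ {y | G.connectedComponentMk y = C ∧ D y = d}, ¬ (l x < l y ∧ r y < r x) := by
        intro x hx y hy
        simp only [Set.mem_ofPred_eq, Prod.mk.injEq] at hx hy
        have h1 := hC x hx.1
        have h2 := hC y hy.1
        exact not_contains_of_dist_eq_succ h h1.2.2
          (by rw [← h1.1, ← h2.1, hx.2.1, hy.2]) h2.2.1
      cases b
      · have := colorable_induce_of_crossed h.dual
          {x | (G.connectedComponentMk x, D x, side x) = (C, d + 1, false)}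
          {y | G.connectedComponentMk y = C ∧ D y = d} ?_
          (fun x hx y hy hc => hsub x hx y hy hc.symm) hn hK
          (by rw [overlapGraph_dual]; exact hfree)
        · rwa [overlapGraph_dual] at this
        · intro x hx
          simp only [Set.mem_ofPred_eq, Prod.mk.injEq] at hx
          have h1 := hC x hx.1
          obtain ⟨y, hyx, hy, hyd⟩ := exists_adj_dist_eq h1.2.1 (h1.1 ▸ hx.2.1)
          have hyC : G.connectedComponentMk y = C := (hadj y x hyx).trans hx.1
          have hyd' : D y = d := (hC y hyC).1.trans hyd
          refine ⟨y, ⟨hyC, hyd'⟩, crossesLeft_dual.2 (hyx.resolve_left fun hc => ?_)⟩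
          exact decide_eq_false_iff_not.1 hx.2.2 ⟨y, hc, by omega⟩
      · refine colorable_induce_of_crossed h _
          {y | G.connectedComponentMk y = C ∧ D y = d} ?_ hsub hn hK hfree
        intro x hx
        simp only [Set.mem_ofPred_eq, Prod.mk.injEq] at hx
        obtain ⟨y, hyx, hyd⟩ := of_decide_eq_true hx.2.2
        exact ⟨y, ⟨(hadj y x (Or.inl hyx)).trans hx.1, by omega⟩, hyx⟩

/-- Overlap graphs are `χ`-bounded. -/
theorem exists_overlapBound (n : ℕ) : ∃ K, OverlapBound n K := by
  induction n with
  | zero => exact ⟨0, fun V α _ _ l r _ hf => (hf ∅ (by simp)).elim⟩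
  | succ n ih =>
    rcases eq_or_ne n 0 with rfl | hn
    · refine ⟨0, fun V α _ _ l r _ hf => ?_⟩
      have : IsEmpty V := ⟨fun x => hf {x} (by simp)⟩
      exact SimpleGraph.Colorable.of_isEmpty 0
    · obtain ⟨K, hK⟩ := ih
      exact ⟨_, hK.succ hn⟩

end

/-! ### Circle graphs as overlap graphs -/

theorem exists_equiv_fin_strictMono {P α : Type} [Finite P] [LinearOrder α] (pos : P → α)
    (hpos : Function.Injective pos) : ∃ e : Fin (Nat.card P) ≃ P, StrictMono (pos ∘ e) := by
  let _ := Fintype.ofFinite P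
  let _ : LinearOrder P := LinearOrder.lift' pos hpos
  exact ⟨(Fintype.orderIsoFinOfCardEq P Nat.card_eq_fintype_card.symm).toEquiv, fun _ _ h =>
    (Fintype.orderIsoFinOfCardEq P Nat.card_eq_fintype_card.symm).lt_iff_lt.2 h⟩

theorem OrderedMatching.isIntervalFamily (M : OrderedMatching) :
    IsIntervalFamily (fun a : M.arcs => a.1.1) (fun a : M.arcs => a.1.2) where
  lt a := M.left_lt_right _ a.2
  left_inj a b h := Subtype.ext ((M.existsUnique_arc a.1.1 (M.endpoints_mem _ a.2).1).unique
    ⟨a.2, Or.inl rfl⟩ ⟨b.2, Or.inl h.symm⟩)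
  right_inj a b h := Subtype.ext ((M.existsUnique_arc a.1.2 (M.endpoints_mem _ a.2).2).unique
    ⟨a.2, Or.inr rfl⟩ ⟨b.2, Or.inr h.symm⟩)
  left_ne_right a b h := by
    have hab : a.1 = b.1 := (M.existsUnique_arc a.1.1 (M.endpoints_mem _ a.2).1).unique
      ⟨a.2, Or.inl rfl⟩ ⟨b.2, Or.inr h.symm⟩
    have hb := M.left_lt_right _ b.2
    rw [← hab] at hb
    exact hb.ne (h.trans (by rw [hab]))

/-- The endpoints in an arbitrary linear order are replaced by their ranks. -/
theorem IsIntervalFamily.isCircleGraph {V α : Type} [Finite V] [LinearOrder α] {l r : V → α}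
    (h : IsIntervalFamily l r) : IsCircleGraph (overlapGraph l r) := by
  classical
  let _ := Fintype.ofFinite V
  have hinj : Function.Injective (Sum.elim l r) :=
    h.left_inj.sumElim h.right_inj h.left_ne_right
  obtain ⟨e, he⟩ := exists_equiv_fin_strictMono _ hinj
  let g : V ⊕ V → ℝ := fun z => (e.symm z : ℕ)
  have hg : ∀ y z, g y < g z ↔ Sum.elim l r y < Sum.elim l r z := by
    intro y z
    rw [← e.apply_symm_apply y, ← e.apply_symm_apply z]
    simpa [g] using (he.lt_iff_lt (a := e.symm y) (b := e.symm z)).symm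
  have hginj : Function.Injective g := by
    intro y z hyz
    have := (hg y z).not.1 hyz.not_lt
    have := (hg z y).not.1 hyz.not_gt
    exact hinj (le_antisymm (by order) (by order))
  let arc : V → ℝ × ℝ := fun x => (g (Sum.inl x), g (Sum.inr x))
  have harc : Function.Injective arc := fun x y hxy =>
    Sum.inl_injective (hginj (congrArg Prod.fst hxy))
  let M : OrderedMatching :=
    { points := Finset.univ.image g
      arcs := Finset.univ.image arc
      left_lt_right := by
        intro a ha
        obtain ⟨x, -, rfl⟩ := Finset.mem_image.1 ha
        exact (hg _ _).2 (h.lt x)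
      endpoints_mem := by
        intro a ha
        obtain ⟨x, -, rfl⟩ := Finset.mem_image.1 ha
        exact ⟨Finset.mem_image_of_mem _ (Finset.mem_univ _),
          Finset.mem_image_of_mem _ (Finset.mem_univ _)⟩
      existsUnique_arc := by
        intro z hz
        obtain ⟨w, -, rfl⟩ := Finset.mem_image.1 hz
        refine ⟨arc (Sum.elim id id w),
          ⟨Finset.mem_image_of_mem _ (Finset.mem_univ _), ?_⟩, ?_⟩
        · cases w
          · exact Or.inl rfl
          · exact Or.inr rfl
        · rintro a ⟨ha, haz⟩
          obtain ⟨x, -, rfl⟩ := Finset.mem_image.1 ha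
          rcases haz with haz | haz <;> rw [← hginj haz] <;> rfl }
  refine ⟨M, ⟨(Equiv.ofBijective (fun x => (⟨arc x, Finset.mem_image_of_mem _
    (Finset.mem_univ _)⟩ : M.arcs)) ⟨fun x y hxy => harc (congrArg Subtype.val hxy), ?_⟩), ?_⟩⟩
  · rintro ⟨a, ha⟩
    obtain ⟨x, -, rfl⟩ := Finset.mem_image.1 ha
    exact ⟨x, rfl⟩
  · intro x y
    have hc : ∀ x y : V, CrossesFromLeft (arc x) (arc y) ↔ CrossesLeft l r x y := fun x y =>
      and_congr (hg _ _) (and_congr (hg _ _) (hg _ _))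
    exact or_congr (hc x y) (hc y x)

/-- The `K_n`-free circle graphs are `k`-colourable if and only if the `K_n`-free overlap graphs
are. -/
theorem overlapBound_iff {n k : ℕ} : OverlapBound n k ↔
    ∀ (V : Type) (G : SimpleGraph V), IsCircleGraph G → G.CliqueFree n → G.Colorable k := by
  constructor
  · rintro hK V G ⟨M, ⟨e⟩⟩ hG
    have h := hK M.arcs ℝ _ _ M.isIntervalFamily
      (hG.comap ⟨e.symm.toCopy⟩)
    exact h.of_hom e.toHom
  · intro hk V α _ _ l r h
    exact hk V _ h.isCircleGraph

/-! ### Splittings as colourings without a monochromatic pattern -/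

/-- The occurrence `g` of the pattern `σ` in the point set with horizontal coordinates `pos` and
vertical coordinates `val`. -/
def IsOccurrence {P α β : Type} [Preorder α] [Preorder β] (pos : P → α) (val : P → β) {m : ℕ}
    (σ : Equiv.Perm (Fin m)) (g : Fin m → P) : Prop :=
  StrictMono (pos ∘ g) ∧ ∀ i j, σ i < σ j ↔ val (g i) < val (g j)

/-- A finite point set with distinct horizontal and distinct vertical coordinates is
order-isomorphic to the graph of a permutation. -/
theorem exists_perm_of_points {P α β : Type} [Finite P] [LinearOrder α] [LinearOrder β]
    (pos : P → α) (val : P → β) (hpos : Function.Injective pos) (hval : Function.Injective val) :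
    ∃ (N : ℕ) (π : Equiv.Perm (Fin N)) (e : Fin N ≃ P), ∀ (m : ℕ) (σ : Equiv.Perm (Fin m))
      (g : Fin m → Fin N), IsEmbedding σ π g ↔ IsOccurrence pos val σ (e ∘ g) := by
  obtain ⟨e, he⟩ := exists_equiv_fin_strictMono pos hpos
  obtain ⟨e', he'⟩ := exists_equiv_fin_strictMono val hval
  refine ⟨_, e.trans e'.symm, e, fun m σ g => and_congr ?_ ?_⟩
  · exact ⟨fun h i j hij => he (h hij), fun h i j hij => he.lt_iff_lt.1 (h hij)⟩
  · refine forall₂_congr fun i j => iff_congr Iff.rfl ?_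
    rw [← he'.lt_iff_lt]
    simp

theorem mem_mergeOf_av_iff {m k : ℕ} {σ : Equiv.Perm (Fin m)} {π : FinPerm} :
    π ∈ mergeOf (fun _ : Fin k => Av σ) ↔ ∃ c : Fin π.1 → Fin k,
      ∀ g : Fin m → Fin π.1, IsEmbedding σ π.2 g → ∀ i, ¬ ∀ j, c (g j) = i := by
  constructor
  · rintro ⟨c, hc⟩
    refine ⟨c, fun g hg i hi => ?_⟩
    obtain ⟨ρ, hρ, f, hf, hr⟩ := hc i
    have hgf : ∀ j, ∃ x, f x = g j := fun j => by
      have : g j ∈ Set.range f := hr ▸ hi j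
      exact this
    choose h hh using hgf
    refine hρ ⟨h, fun a b hab => hf.1.lt_iff_lt.1 ?_, fun a b => ?_⟩
    · rw [hh, hh]
      exact hg.1 hab
    · rw [hf.2, hh, hh]
      exact hg.2 a b
  · rintro ⟨c, hc⟩
    refine ⟨c, fun i => ?_⟩
    obtain ⟨N, ρ, e, he⟩ := exists_perm_of_points (P := {x // c x = i}) (fun x => x.1)
      (fun x => π.2 x.1) Subtype.val_injective (π.2.injective.comp Subtype.val_injective)
    refine ⟨⟨N, ρ⟩, ?_, fun x => (e x).1,
      (he N ρ id).1 ⟨strictMono_id, fun _ _ => Iff.rfl⟩, ?_⟩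
    · rintro ⟨g, hg⟩
      exact hc _ ((he m σ g).1 hg) i fun j => (e (g j)).2
    · ext x
      exact ⟨fun ⟨y, hy⟩ => hy ▸ (e y).2, fun hx => ⟨e.symm ⟨x, hx⟩, by simp⟩⟩

/-- Splitting into copies of `Av σ` as a colouring of finite point sets. -/
theorem exists_coloring_of_splits {P α β : Type} [Finite P] [LinearOrder α] [LinearOrder β]
    {pos : P → α} {val : P → β} (hpos : Function.Injective pos) (hval : Function.Injective val)
    {s m k : ℕ} {τ : Equiv.Perm (Fin s)} {σ : Equiv.Perm (Fin m)}
    (h : SplitsIntoCopies (Av τ) k (Av σ)) (hτ : ∀ g, ¬ IsOccurrence pos val τ g) :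
    ∃ c : P → Fin k, ∀ g, IsOccurrence pos val σ g → ∀ i, ¬ ∀ j, c (g j) = i := by
  obtain ⟨N, π, e, he⟩ := exists_perm_of_points pos val hpos hval
  obtain ⟨c, hc⟩ := mem_mergeOf_av_iff.1
    (@h ⟨N, π⟩ fun ⟨g, hg⟩ => hτ _ ((he s τ g).1 hg))
  refine ⟨c ∘ e.symm, fun g hg => hc (e.symm ∘ g) ((he m σ _).2 ?_)⟩
  simpa [Function.comp_def] using hg

/-! ### The patterns `132` and `1 ⊕ δ_n` -/

section

variable {P α β : Type} [Preorder α] [Preorder β] {pos : P → α} {val : P → β}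

theorem isOccurrence_perm132_iff {g : Fin 3 → P} : IsOccurrence pos val perm132 g ↔
    (pos (g 0) < pos (g 1) ∧ pos (g 1) < pos (g 2)) ∧
      val (g 0) < val (g 2) ∧ val (g 2) < val (g 1) := by
  constructor
  · rintro ⟨h1, h2⟩
    exact ⟨⟨h1 (by decide), h1 (by decide)⟩, (h2 0 2).1 (by decide), (h2 2 1).1 (by decide)⟩
  · rintro ⟨⟨h1, h2⟩, h3, h4⟩
    have h5 := h1.trans h2
    have h6 := h3.trans h4
    refine ⟨fun i j hij => ?_, fun i j => ?_⟩
    · fin_cases i <;> fin_cases j <;> first | exact absurd hij (by decide) | assumption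
    · fin_cases i <;> fin_cases j <;>
        first
        | exact iff_of_true (by decide) (by assumption)
        | exact iff_of_false (by decide) (lt_irrefl _)
        | exact iff_of_false (by decide) (lt_asymm (by assumption))

theorem isOccurrence_oneSumDecreasing_iff {n : ℕ} {g : Fin (1 + n) → P} :
    IsOccurrence pos val (oneSumDecreasing n) g ↔
      (∀ i, pos (g (Fin.castAdd n 0)) < pos (g (Fin.natAdd 1 i)) ∧
        val (g (Fin.castAdd n 0)) < val (g (Fin.natAdd 1 i))) ∧
      ∀ i j, i < j → pos (g (Fin.natAdd 1 i)) < pos (g (Fin.natAdd 1 j)) ∧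
        val (g (Fin.natAdd 1 j)) < val (g (Fin.natAdd 1 i)) := by
  have e0 : oneSumDecreasing n (Fin.castAdd n 0) = Fin.castAdd n 0 := by
    simp [oneSumDecreasing, directSum]
  have e1 : ∀ i, oneSumDecreasing n (Fin.natAdd 1 i) = Fin.natAdd 1 (Fin.rev i) := fun i => by
    simp [oneSumDecreasing, directSum, decreasing]
  have h01 : ∀ i : Fin n, Fin.castAdd n (0 : Fin 1) < Fin.natAdd 1 i := fun i =>
    Fin.lt_def.2 (by simp)
  have h11 : ∀ i j : Fin n, Fin.natAdd 1 i < Fin.natAdd 1 j ↔ i < j := fun i j => by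
    rw [Fin.lt_def, Fin.lt_def, Fin.val_natAdd, Fin.val_natAdd, Nat.add_lt_add_iff_left]
  constructor
  · rintro ⟨h1, h2⟩
    refine ⟨fun i => ⟨h1 (h01 i), (h2 _ _).1 ?_⟩, fun i j hij =>
      ⟨h1 ((h11 i j).2 hij), (h2 _ _).1 ?_⟩⟩
    · rw [e0, e1]
      exact h01 _
    · rw [e1, e1, h11]
      exact Fin.rev_lt_rev.2 hij
  · rintro ⟨h1, h2⟩
    refine ⟨fun i j => ?_, fun i j => ?_⟩
    · induction i using Fin.addCases with
      | left i =>
        obtain rfl := Subsingleton.elim 0 i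
        induction j using Fin.addCases with
        | left j =>
          obtain rfl := Subsingleton.elim 0 j
          exact fun h => (lt_irrefl _ h).elim
        | right j => exact fun _ => (h1 j).1
      | right i =>
        induction j using Fin.addCases with
        | left j =>
          obtain rfl := Subsingleton.elim 0 j
          exact fun h => (lt_asymm h (h01 i)).elim
        | right j => exact fun h => (h2 i j ((h11 i j).1 h)).1
    · induction i using Fin.addCases with
      | left i =>
        obtain rfl := Subsingleton.elim 0 i
        induction j using Fin.addCases with
        | left j =>
          obtain rfl := Subsingleton.elim 0 j
          exact iff_of_false (lt_irrefl _) (lt_irrefl _)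
        | right j =>
          rw [e0, e1]
          exact iff_of_true (h01 _) (h1 j).2
      | right i =>
        induction j using Fin.addCases with
        | left j =>
          obtain rfl := Subsingleton.elim 0 j
          rw [e0, e1]
          exact iff_of_false (lt_asymm (h01 _)) (lt_asymm (h1 i).2)
        | right j =>
          rw [e1, e1, h11, Fin.rev_lt_rev]
          rcases lt_trichotomy i j with h | rfl | h
          · exact iff_of_false (lt_asymm h) (lt_asymm (h2 i j h).2)
          · exact iff_of_false (lt_irrefl _) (lt_irrefl _)
          · exact iff_of_true h (h2 j i h).2

end

theorem exists_isOccurrence_oneSumDecreasing {P α β : Type} [Preorder α] [Preorder β]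
    {pos : P → α} {val : P → β} {n : ℕ} (m : P) (q : Fin n → P)
    (hm : ∀ i, pos m < pos (q i) ∧ val m < val (q i))
    (hq : ∀ i j, i < j → pos (q i) < pos (q j) ∧ val (q j) < val (q i)) :
    ∃ g, IsOccurrence pos val (oneSumDecreasing n) g :=
  ⟨Fin.append (fun _ => m) q, isOccurrence_oneSumDecreasing_iff.2
    ⟨by simpa only [Fin.append_left, Fin.append_right] using hm,
      by simpa only [Fin.append_right] using hq⟩⟩

/-! ### From colourings of overlap graphs to splittings -/

/-- Send a point `x` of a `1 ⊕ δ_n`-avoiding permutation `π` to the interval of left-to-right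
minima that are below and to the left of it. Two points cross when some `m` completes them to an
occurrence of `132`, and by the Helly property an `n`-clique is completed to `1 ⊕ δ_n` by
one `m`. -/
theorem splits_of_overlapBound {n k : ℕ} (hn : 2 ≤ n) (hk : OverlapBound n k) :
    SplitsIntoCopies (Av (oneSumDecreasing n)) k (Av perm132) := by
  rintro ⟨N, π⟩ hπ
  -- `μ x` is the first left-to-right minimum not above `x`
  have hex : ∀ x, ∃ m, π m ≤ π x ∧ ∀ y, π y ≤ π x → m ≤ y := fun x =>
    Set.exists_min_image {y | π y ≤ π x} id (Set.toFinite _) ⟨x, by simp⟩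
  choose μ hμ hmin using hex
  let l : Fin N → Fin N ×ₗ (Bool ×ₗ (Fin N)ᵒᵈ) := fun x =>
    toLex (μ x, toLex (false, OrderDual.toDual (π x)))
  let r : Fin N → Fin N ×ₗ (Bool ×ₗ (Fin N)ᵒᵈ) := fun x =>
    toLex (x, toLex (true, OrderDual.toDual (π x)))
  have hlr : ∀ x y, l x < r y ↔ μ x ≤ y := fun x y => by
    simp [l, r, Prod.Lex.toLex_lt_toLex, le_iff_lt_or_eq]
  have hll : ∀ x y, l x < l y ↔ π y < π x := fun x y => by
    simp only [l, Prod.Lex.toLex_lt_toLex, lt_irrefl, false_or, true_and,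
      OrderDual.toDual_lt_toDual]
    refine ⟨?_, fun h => ?_⟩
    · rintro (h | h)
      · exact not_le.1 fun h' => (hmin y (μ x) ((hμ x).trans h')).not_gt h
      · exact h.2
    · rcases (hmin x (μ y) ((hμ y).trans h.le)).lt_or_eq with h' | h'
      · exact Or.inl h'
      · exact Or.inr ⟨h', h⟩
  have hrr : ∀ x y, r x < r y ↔ x < y := fun x y => by
    simp only [r, Prod.Lex.toLex_lt_toLex, lt_irrefl, false_or, true_and,
      OrderDual.toDual_lt_toDual, or_iff_left_iff_imp]
    rintro ⟨rfl, h⟩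
    exact (lt_irrefl _ h).elim
  have hfam : IsIntervalFamily l r :=
    { lt := fun x => (hlr x x).2 (hmin x x le_rfl)
      left_inj := fun x y e => π.injective
        (OrderDual.toDual.injective (congrArg (fun z => (ofLex (ofLex z).2).2) e))
      right_inj := fun x y e => congrArg (fun z => (ofLex z).1) e
      left_ne_right := fun x y e =>
        Bool.noConfusion (show false = true from congrArg (fun z => (ofLex (ofLex z).2).1) e) }
  have hcross : ∀ x y, CrossesLeft l r x y ↔ π y < π x ∧ μ y ≤ x ∧ x < y := fun x y =>
    and_congr (hll x y) (and_congr (hlr y x) (hrr x y))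
  obtain ⟨c⟩ := hk _ _ l r hfam (by
    intro s hs
    have : NeZero n := ⟨by omega⟩
    let f := s.orderEmbOfFin hs.card_eq
    have hf : ∀ i j, i < j → CrossesLeft l r (f i) (f j) := by
      intro i j hij
      have hlt : f i < f j := f.lt_iff_lt.2 hij
      refine (hs.isClique (s.orderEmbOfFin_mem hs.card_eq i) (s.orderEmbOfFin_mem hs.card_eq j)
        hlt.ne).resolve_right fun h => ?_
      exact hlt.not_gt ((hcross _ _).1 h).2.2
    let z : Fin n := ⟨n - 1, by omega⟩
    have hz : ∀ i, i ≤ z := fun i => Fin.le_def.2 (by simp only [z]; omega)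
    have h0z : (0 : Fin n) < z := Fin.lt_def.2 (by simp only [z, Fin.val_zero]; omega)
    have hm0 : μ (f z) < f 0 := by
      have h := (hcross _ _).1 (hf 0 z h0z)
      refine lt_of_le_of_ne h.2.1 fun e => ?_
      have := hμ (f z)
      rw [e] at this
      exact this.not_gt h.1
    refine hπ (exists_isOccurrence_oneSumDecreasing (pos := id) (val := π) (μ (f z)) f ?_ ?_)
    · intro i
      have h1 : μ (f z) < f i := hm0.trans_le (f.le_iff_le.2 (Fin.zero_le i))
      refine ⟨h1, lt_of_le_of_ne ((hμ (f z)).trans ?_) fun e => h1.ne (π.injective e)⟩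
      rcases (hz i).lt_or_eq with h | h
      · exact ((hcross _ _).1 (hf i z h)).1.le
      · rw [h]
    · exact fun i j hij => ⟨f.lt_iff_lt.2 hij, ((hcross _ _).1 (hf i j hij)).1⟩)
  refine mem_mergeOf_av_iff.2 ⟨c, fun g hg i hi => ?_⟩
  obtain ⟨⟨h1, h2⟩, h3, h4⟩ := (isOccurrence_perm132_iff (pos := id) (val := π)).1 hg
  exact c.valid (Or.inl ((hcross (g 1) (g 2)).2 ⟨h4, (hmin _ _ h3.le).trans h1.le, h2⟩))
    ((hi 1).trans (hi 2).symm)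

/-! ### From splittings to colourings of overlap graphs -/

section

variable {V : Type} {α : Type} [LinearOrder α] (l r : V → α) {t : ℕ} (τ : Equiv.Perm (Fin t))

/-- Horizontal coordinates of the permutation that has one point for each interval, and, for each
interval, a copy of `τ` whose points are close to one another. The copy belonging to `a` is placed
at the left endpoint of `a`, the point belonging to `x` at its right endpoint. -/
def inflatedPos : V ⊕ V × Fin t → α ×ₗ ℕ
  | Sum.inl x => toLex (r x, 0)
  | Sum.inr (a, j) => toLex (l a, j)

/-- Vertical coordinates of the permutation in `inflatedPos`: they decrease with the left endpoint,
and the copy of `τ` belonging to `a` is just below the point belonging to `a`. -/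
def inflatedVal : V ⊕ V × Fin t → αᵒᵈ ×ₗ ℕ
  | Sum.inl x => toLex (OrderDual.toDual (l x), t)
  | Sum.inr (a, j) => toLex (OrderDual.toDual (l a), τ j)

variable {l r}

theorem inflatedPos_injective (h : IsIntervalFamily l r) :
    Function.Injective (inflatedPos (t := t) l r) := by
  rintro (x | ⟨a, i⟩) (y | ⟨b, j⟩) e <;>
    simp only [inflatedPos, EmbeddingLike.apply_eq_iff_eq, Prod.mk.injEq] at e
  · rw [h.right_inj e.1]
  · exact (h.left_ne_right _ _ e.1.symm).elim
  · exact (h.left_ne_right _ _ e.1).elim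
  · rw [h.left_inj e.1, Fin.ext e.2]

theorem inflatedVal_injective (h : IsIntervalFamily l r) :
    Function.Injective (inflatedVal l τ) := by
  rintro (x | ⟨a, i⟩) (y | ⟨b, j⟩) e <;>
    simp only [inflatedVal, EmbeddingLike.apply_eq_iff_eq, Prod.mk.injEq] at e
  · rw [h.left_inj e.1]
  · exact ((τ j).2.ne e.2.symm).elim
  · exact ((τ i).2.ne e.2).elim
  · rw [h.left_inj e.1, τ.injective (Fin.ext e.2)]

variable {τ}

/-- A point below and to the left of a point of the copy of `τ` belonging to `a` lies in that copy,
and so do all points between two points of the copy. Hence an occurrence of `1 ⊕ δ_n` either lies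
in one copy of `τ` or yields `n` pairwise crossing intervals. -/
theorem not_isOccurrence_inflated (h : IsIntervalFamily l r) {n : ℕ}
    (hfree : (overlapGraph l r).CliqueFree n) (hτ : (⟨t, τ⟩ : FinPerm) ∈ Av (oneSumDecreasing n))
    (g : Fin (1 + n) → V ⊕ V × Fin t) :
    ¬ IsOccurrence (inflatedPos l r) (inflatedVal l τ) (oneSumDecreasing n) g := by
  intro hg
  obtain ⟨h1, h2⟩ := isOccurrence_oneSumDecreasing_iff.1 hg
  generalize g (Fin.castAdd n 0) = m at h1
  generalize hq : (fun i => g (Fin.natAdd 1 i)) = q at *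
  have h1 : ∀ i, inflatedPos l r m < inflatedPos l r (q i) ∧
      inflatedVal l τ m < inflatedVal l τ (q i) := fun i => by rw [← hq]; exact h1 i
  have h2 : ∀ i j, i < j → inflatedPos l r (q i) < inflatedPos l r (q j) ∧
      inflatedVal l τ (q j) < inflatedVal l τ (q i) := fun i j hij => by
    rw [← hq]; exact h2 i j hij
  by_cases hcopy : ∃ i a j, q i = Sum.inr (a, j)
  · obtain ⟨i, a, j, hi⟩ := hcopy
    obtain ⟨j₀, rfl⟩ : ∃ j₀, m = Sum.inr (a, j₀) := by
      have h3 := h1 i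
      rw [hi] at h3
      rcases m with x | ⟨b, j₀⟩ <;>
        simp only [inflatedPos, inflatedVal, Prod.Lex.toLex_lt_toLex,
          OrderDual.toDual_lt_toDual] at h3
      · have h4 := h.lt x
        have h5 := (τ j).2
        rcases h3 with ⟨h3 | h3, h6 | h6⟩
        · exact (lt_asymm (h6.trans h4) h3).elim
        · exact (lt_asymm h5 h6.2).elim
        · exact ((h.left_ne_right _ _ h3.1.symm)).elim
        · exact (lt_asymm h5 h6.2).elim
      · have : l b = l a := by
          rcases h3 with ⟨h3 | h3, h6 | h6⟩
          · exact (lt_asymm h3 h6).elim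
          · exact OrderDual.toDual.injective h6.1
          · exact h3.1
          · exact h3.1
        exact ⟨j₀, by rw [h.left_inj this]⟩
    have hall : ∀ i', ∃ j', q i' = Sum.inr (a, j') := by
      intro i'
      have h3 := h1 i'
      rcases hx : q i' with x | ⟨b, j'⟩
      · exfalso
        rw [hx] at h3
        rcases lt_trichotomy i' i with hlt | rfl | hlt
        · have h4 := (h2 _ _ hlt).1
          rw [hx, hi] at h4
          simp only [inflatedPos, Prod.Lex.toLex_lt_toLex] at h3 h4
          have h5 := h.left_ne_right a x
          rcases h3.1 with h6 | h6
          · rcases h4 with h7 | h7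
            · exact lt_asymm h6 h7
            · exact h5 h7.1.symm
          · exact h5 h6.1
        · rw [hx] at hi
          exact Sum.inl_ne_inr hi
        · have h4 := (h2 _ _ hlt).2
          rw [hx, hi] at h4
          simp only [inflatedVal, Prod.Lex.toLex_lt_toLex, OrderDual.toDual_lt_toDual] at h3 h4
          have h5 := (τ j).2
          rcases h4 with h7 | h7
          · rcases h3.2 with h6 | h6
            · exact lt_asymm h6 h7
            · exact h7.ne (OrderDual.toDual.injective h6.1)
          · exact lt_asymm h5 h7.2
      · have h6 : l a = l b := by
          simp only [hx, inflatedPos, inflatedVal, Prod.Lex.toLex_lt_toLex,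
            OrderDual.toDual_lt_toDual] at h3
          rcases h3 with ⟨h3 | h3, h6 | h6⟩
          · exact (lt_asymm h3 h6).elim
          · exact OrderDual.toDual.injective h6.1
          · exact h3.1
          · exact h3.1
        exact ⟨j', by rw [h.left_inj h6]⟩
    choose p hp using hall
    simp only [hp, inflatedPos, inflatedVal, Prod.Lex.toLex_lt_toLex, lt_irrefl, false_or,
      true_and, Fin.val_fin_lt] at h1 h2
    exact hτ (exists_isOccurrence_oneSumDecreasing (pos := id) (val := τ) j₀ p h1 h2)
  · push Not at hcopy
    have hall : ∀ i, ∃ x, q i = Sum.inl x := by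
      intro i
      rcases hx : q i with x | ⟨a, j⟩
      · exact ⟨x, rfl⟩
      · exact (hcopy i a j hx).elim
    choose x hx using hall
    simp only [hx] at h1 h2
    have hr : ∀ i j, i < j → r (x i) < r (x j) := fun i j hij => by
      have := (h2 i j hij).1
      simpa [inflatedPos, Prod.Lex.toLex_lt_toLex] using this
    have hl : ∀ i j, i < j → l (x i) < l (x j) := fun i j hij => by
      have := (h2 i j hij).2
      simpa [inflatedVal, Prod.Lex.toLex_lt_toLex] using this
    have hlr : ∀ i j, l (x i) < r (x j) := by
      intro i j
      have h3 := (h1 j).1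
      have h4 := (h1 i).2
      rcases m with y | ⟨a, j₀⟩ <;>
        simp only [inflatedPos, inflatedVal, Prod.Lex.toLex_lt_toLex,
          OrderDual.toDual_lt_toDual, lt_irrefl, and_false, or_false] at h3 h4
      · exact h4.trans ((h.lt y).trans h3)
      · have h5 : l a < r (x j) := h3.elim id fun h3 => (h.left_ne_right _ _ h3.1).elim
        exact h4.elim (fun h4 => h4.trans h5) fun h4 =>
          (OrderDual.toDual.injective h4.1) ▸ h5
    have hinj : Function.Injective x := fun i j e => by
      rcases lt_trichotomy i j with hij | hij | hij
      · exact ((hr _ _ hij).ne (congrArg r e)).elim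
      · exact hij
      · exact ((hr _ _ hij).ne (congrArg r e.symm)).elim
    refine hfree (Finset.univ.map ⟨x, hinj⟩) ⟨?_, by simp⟩
    intro u hu v hv huv
    obtain ⟨i, -, rfl⟩ := Finset.mem_map.1 hu
    obtain ⟨j, -, rfl⟩ := Finset.mem_map.1 hv
    rcases lt_trichotomy i j with hij | rfl | hij
    · exact Or.inl ⟨hl _ _ hij, hlr _ _, hr _ _ hij⟩
    · exact (huv rfl).elim
    · exact Or.inr ⟨hl _ _ hij, hlr _ _, hr _ _ hij⟩

end

/-- If `k` is the least number of copies into which a class of avoiders splits, some member of the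
class needs all `k` colours. -/
theorem exists_mem_av_surjective {s m k : ℕ} {σ : Equiv.Perm (Fin m)} {ρ : Equiv.Perm (Fin (s + 1))}
    (hmin : ∀ k' < k, ¬ SplitsIntoCopies (Av ρ) k' (Av σ)) :
    ∃ τ ∈ Av ρ, ∀ c : Fin τ.1 → Fin k,
      (∀ g, IsEmbedding σ τ.2 g → ∀ i, ¬ ∀ j, c (g j) = i) → Function.Surjective c := by
  rcases k with _ | k
  · exact ⟨⟨0, 1⟩, fun ⟨f, _⟩ => (f 0).elim0, fun c _ i => i.elim0⟩
  · obtain ⟨τ, hτ, hτ'⟩ := Set.not_subset.1 (hmin k k.lt_succ_self)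
    refine ⟨τ, hτ, fun c hc => ?_⟩
    by_contra hsurj
    simp only [Function.Surjective, not_forall, not_exists] at hsurj
    obtain ⟨i, hi⟩ := hsurj
    choose c' hc' using fun x => Fin.exists_succAbove_eq (hi x)
    exact hτ' (mem_mergeOf_av_iff.2 ⟨c', fun g hg i' hi' => hc g hg (i.succAbove i') fun j => by
      rw [← hc', hi' j]⟩)

/-- For the least `k`, replace the left-to-right minima by copies of a permutation that needs all
`k` colours. Then each colour is present among the minima below any crossing pair. -/
theorem overlapBound_of_splits {n k : ℕ} (hn : 2 ≤ n)
    (hk : SplitsIntoCopies (Av (oneSumDecreasing n)) k (Av perm132)) : OverlapBound n k := by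
  classical
  intro V α _ _ l r h hfree
  have hex : ∃ k, SplitsIntoCopies (Av (oneSumDecreasing n)) k (Av perm132) := ⟨k, hk⟩
  refine SimpleGraph.Colorable.mono (Nat.find_min' hex hk) ?_
  obtain ⟨⟨t, τ⟩, hτ, hsurj⟩ : ∃ τ ∈ Av (oneSumDecreasing n), ∀ c : Fin τ.1 → Fin (Nat.find hex),
      (∀ g, IsEmbedding perm132 τ.2 g → ∀ i, ¬ ∀ j, c (g j) = i) → Function.Surjective c := by
    obtain ⟨n, rfl⟩ := Nat.exists_eq_add_of_le' hn
    exact exists_mem_av_surjective (s := 1 + (n + 1)) fun k' hk' => Nat.find_min hex hk'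
  obtain ⟨c, hc⟩ := exists_coloring_of_splits (inflatedPos_injective (t := t) h)
    (inflatedVal_injective τ h) (Nat.find_spec hex) (not_isOccurrence_inflated h hfree hτ)
  have key : ∀ x y, CrossesLeft l r x y → c (Sum.inl x) ≠ c (Sum.inl y) := by
    intro x y hxy e
    obtain ⟨j, hj⟩ := hsurj (fun j => c (Sum.inr (y, j))) (fun g hg =>
      hc (fun i => Sum.inr (y, g i)) ⟨fun i j hij => by
        simpa [inflatedPos, Prod.Lex.toLex_lt_toLex] using hg.1 hij, fun i j => by
        simpa [inflatedVal, Prod.Lex.toLex_lt_toLex] using hg.2 i j⟩) (c (Sum.inl y))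
    refine hc ![Sum.inr (y, j), Sum.inl x, Sum.inl y]
      (isOccurrence_perm132_iff.2 ⟨⟨?_, ?_⟩, ?_, ?_⟩) (c (Sum.inl y)) fun i => ?_
    · exact Prod.Lex.toLex_lt_toLex.2 (Or.inl hxy.2.1)
    · exact Prod.Lex.toLex_lt_toLex.2 (Or.inl hxy.2.2)
    · exact Prod.Lex.toLex_lt_toLex.2 (Or.inr ⟨rfl, (τ j).2⟩)
    · exact Prod.Lex.toLex_lt_toLex.2 (Or.inl hxy.1)
    · fin_cases i
      · exact hj
      · exact e
      · rfl
  exact ⟨SimpleGraph.Coloring.mk (fun x => c (Sum.inl x)) fun {x y} hxy =>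
    hxy.elim (key x y) fun hxy => (key y x hxy).symm⟩

theorem splits_iff_overlapBound {n k : ℕ} (hn : 2 ≤ n) :
    SplitsIntoCopies (Av (oneSumDecreasing n)) k (Av perm132) ↔ OverlapBound n k :=
  ⟨overlapBound_of_splits hn, splits_of_overlapBound hn⟩

/-- A permutation avoiding `12` avoids `132`, so one colour suffices. -/
theorem splits_oneSumDecreasing_one {k : ℕ} (hk : k ≠ 0) :
    SplitsIntoCopies (Av (oneSumDecreasing 1)) k (Av perm132) := by
  rintro ⟨N, π⟩ hπ
  refine mem_mergeOf_av_iff.2 ⟨fun _ => ⟨0, Nat.pos_of_ne_zero hk⟩, fun g hg _ _ => ?_⟩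
  obtain ⟨⟨h1, -⟩, h2, h3⟩ := (isOccurrence_perm132_iff (pos := id) (val := π)).1 hg
  exact hπ (exists_isOccurrence_oneSumDecreasing (pos := id) (val := π) (g 0) (fun _ => g 1)
    (fun _ => ⟨h1, h2.trans h3⟩) fun i j hij => (hij.ne (Subsingleton.elim i j)).elim)

/-! ### The largest chromatic number -/

/-- If `f` is the least number of colours sufficient for all graphs in question, one of them has
chromatic number `f`. -/
theorem isGreatest_chromaticNumber {n f : ℕ}
    (hf : IsLeast {k | OverlapBound n k} f) (hn : n ≠ 0) :
    IsGreatest {c : ℕ∞ | ∃ (V : Type) (G : SimpleGraph V),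
      IsCircleGraph G ∧ G.CliqueFree n ∧ G.chromaticNumber = c} (f : ℕ∞) := by
  have hup := overlapBound_iff.1 hf.1
  constructor
  · rcases f with _ | f
    · refine ⟨Empty, overlapGraph (α := ℕ) Empty.elim Empty.elim,
        IsIntervalFamily.isCircleGraph ⟨fun x => x.elim, fun x => x.elim, fun x => x.elim,
          fun x => x.elim⟩,
        SimpleGraph.cliqueFree_of_card_lt (by simpa using Nat.pos_of_ne_zero hn), ?_⟩
      simp
    · have hnot : ¬ OverlapBound n f := fun h => (hf.2 h).not_gt f.lt_succ_self
      rw [overlapBound_iff] at hnot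
      push Not at hnot
      obtain ⟨V, G, hG, hfree, hcol⟩ := hnot
      refine ⟨V, G, hG, hfree, le_antisymm (hup V G hG hfree).chromaticNumber_le ?_⟩
      rw [← SimpleGraph.chromaticNumber_le_iff_colorable, not_le] at hcol
      exact_mod_cast Order.add_one_le_of_lt hcol
  · rintro c ⟨V, G, hG, hfree, rfl⟩
    exact (hup V G hG hfree).chromaticNumber_le

end PermSplitting

open PermSplitting
theorem proposition3 :
    (∀ n k : ℕ, 1 ≤ n → ¬ (n = 1 ∧ k = 0) →
      (SplitsIntoCopies (Av (oneSumDecreasing n)) k (Av perm132) ↔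
        ∀ (V : Type) (G : SimpleGraph V), IsCircleGraph G → G.CliqueFree n → G.Colorable k)) ∧
    (∀ n : ℕ, 2 ≤ n → ∃ f : ℕ,
      IsLeast {k : ℕ | SplitsIntoCopies (Av (oneSumDecreasing n)) k (Av perm132)} f ∧
      IsGreatest {c : ℕ∞ | ∃ (V : Type) (G : SimpleGraph V),
        IsCircleGraph G ∧ G.CliqueFree n ∧ G.chromaticNumber = c} (f : ℕ∞)) := by
  classical
  constructor
  · intro n k hn hnk
    rcases hn.eq_or_lt with rfl | hn
    · refine iff_of_true (splits_oneSumDecreasing_one fun hk => hnk ⟨rfl, hk⟩) fun V G _ hG => ?_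
      have : IsEmpty V := ⟨fun x => hG {x} (by simp)⟩
      exact SimpleGraph.Colorable.of_isEmpty k
    · rw [splits_iff_overlapBound hn, overlapBound_iff]
  · intro n hn
    have hex := exists_overlapBound n
    have hleast : IsLeast {k | OverlapBound n k} (Nat.find hex) :=
      ⟨Nat.find_spec hex, fun k hk => Nat.find_min' hex hk⟩
    refine ⟨Nat.find hex, ?_, isGreatest_chromaticNumber hleast (by omega)⟩
    simpa only [splits_iff_overlapBound hn] using hleast
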